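/- Let $\mathfrak L$ be an $L_\infty$-algebra over $\mathbb R$ concentrated in non-positive degrees, given dually by its Chevalley--Eilenberg algebra: a free graded-commutative algebra on the generators $t^\alpha$ of degree $|t^\alpha|=1-|e_\alpha|\ge 1$ that are shifted-dual to a homogeneous basis $(e_\alpha)$ of $\mathfrak L$, with a differential $d_{\rm CE}$ of degree $1$. Let $W(\mathfrak L)$ be its Weil algebra, the free graded-commutative algebra on the $t^\alpha$ and on generators $\sigma(t^\alpha)$ of degree $|t^\alpha|+1$, where $\sigma$ is extended to a derivation of degree $1$ with $\sigma^2=0$, with differential $$d_W t^\alpha=d_{\rm CE}t^\alpha+\sigma(t^\alpha),\qquad d_W\sigma(t^\alpha)=-\sigma(d_W t^\alpha).$$ Let $\phi$ be an adjustment of $\mathfrak L$. That is, $\phi$ is a degree-preserving algebra automorphism of $W(\mathfrak L)$ (not necessarily commuting with $d_W$) with $\phi(t^\alpha)=t^\alpha$ that covers the identity under the projection $W(\mathfrak L)\to \mathrm{CE}(\mathfrak L)$, $\sigma(t^\alpha)\mapsto 0$, and for which setting all curvature ghosts to zero is compatible with the BRST differential. The last condition means: for every contractible manifold $U$, every graded-commutative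 algebra $B=\bigoplus_{j\ge 0}B_j$ (graded by ghost degree), and every algebra morphism $\mathcal A:W(\mathfrak L)\to \Omega^\bullet(U)\otimes B$ with $$\mathcal A(t^\alpha)\in\bigoplus_{0\le j\le |t^\alpha|}\Omega^{|t^\alpha|-j}(U)\otimes B_j,\qquad \mathcal A(\phi(\sigma(t^\alpha)))\in\Omega^{|t^\alpha|+1}(U)\otimes B_0$$ for all $\alpha$, the components of ghost degree $j+1$ of $\mathcal A(d_W\phi(\sigma(t^\alpha)))$ vanish for all $j\ge 1$ and all $\alpha$. Then there are real structure constants $m^\alpha_{\alpha_1\ldots\alpha_i}$ and $n^\alpha_{\alpha_0\alpha_1\ldots\alpha_i}$ ($i\ge 1$), only finitely many of which are non-zero for each $\alpha$, depending only on $\mathfrak L$ and $\phi$, such that $n^\alpha_{\alpha_0\alpha_1\ldots\alpha_i}=0$ unless $|t^{\alpha_0}|=1$, and such that the following holds. For every contractible manifold $U$ and every $\mathfrak L$-valued connection on $U$, i.e. every morphism of differential graded algebras $\mathcal A:(W(\mathfrak L),d_W)\to(\Omega^\bullet(U),d)$, with gauge potentials $A^\alpha=\mathcal A(t^\alpha)$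 and adjusted curvatures $F^\alpha=\mathcal A(\phi(\sigma(t^\alpha)))$, the Bianchi identities are $$dF^\alpha=\sum_{i\ge 1}\frac1{i!}\sum_{\alpha_0,\alpha_1,\ldots,\alpha_i}n^\alpha_{\alpha_0\alpha_1\ldots\alpha_i}A^{\alpha_0}F^{\alpha_1}\cdots F^{\alpha_i}+\sum_{i\ge 1}\frac1{i!}\sum_{\alpha_1,\ldots,\alpha_i}m^\alpha_{\alpha_1\ldots\alpha_i}F^{\alpha_1}\cdots F^{\alpha_i}$$ for all $\alpha$. -/

import Mathlib

open scoped Manifold ContDiff TensorProduct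

universe u v

noncomputable section

/-! ## Free graded-commutative algebras -/

/-- The relations `g h = (-1)^{|g||h|} h g` between generators. Over `ℝ` they force the square of an
odd generator to vanish. -/
inductive GCRel {G : Type*} (deg : G → ℕ) : FreeAlgebra ℝ G → FreeAlgebra ℝ G → Prop
  | comm (g h : G) : GCRel deg (FreeAlgebra.ι ℝ g * FreeAlgebra.ι ℝ h)
      (((-1 : ℝ) ^ (deg g * deg h)) • (FreeAlgebra.ι ℝ h * FreeAlgebra.ι ℝ g))

/-- The free graded-commutative real algebra `⊙ V` on the graded vector space `V` with homogeneous
basis `G`, the basis element `g` having degree `deg g`. -/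
abbrev FreeGC {G : Type*} (deg : G → ℕ) : Type _ := RingQuot (GCRel deg)

namespace FreeGC

variable {G : Type*} {deg : G → ℕ}

/-- The generator `g` of the free graded-commutative algebra. -/
def gen (deg : G → ℕ) (g : G) : FreeGC deg :=
  RingQuot.mkAlgHom ℝ (GCRel deg) (FreeAlgebra.ι ℝ g)

/-- The subspace of elements of degree `p`, spanned by the words of total degree `p`. -/
def homog (deg : G → ℕ) (p : ℕ) : Submodule ℝ (FreeGC deg) :=
  Submodule.span ℝ {x | ∃ l : List G, (l.map deg).sum = p ∧ (l.map (gen deg)).prod = x}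

/-- The universal property of the free graded-commutative algebra. -/
def lift {A : Type*} [Ring A] [Algebra ℝ A] (f : G → A)
    (hf : ∀ g h, f g * f h = ((-1 : ℝ) ^ (deg g * deg h)) • (f h * f g)) :
    FreeGC deg →ₐ[ℝ] A :=
  RingQuot.liftAlgHom ℝ ⟨FreeAlgebra.lift ℝ f, by
    rintro _ _ ⟨g, h⟩
    simp [hf g h]⟩

@[simp] theorem lift_gen {A : Type*} [Ring A] [Algebra ℝ A] (f : G → A)
    (hf : ∀ g h, f g * f h = ((-1 : ℝ) ^ (deg g * deg h)) • (f h * f g)) (g : G) :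
    lift f hf (gen deg g) = f g := by
  simp [lift, gen]

theorem gen_comm (g h : G) : gen deg g * gen deg h =
    ((-1 : ℝ) ^ (deg g * deg h)) • (gen deg h * gen deg g) := by
  have := RingQuot.mkAlgHom_rel ℝ (GCRel.comm (deg := deg) g h)
  simpa [gen] using this

theorem prod_mem (l : List G) : (l.map (gen deg)).prod ∈ homog deg (l.map deg).sum :=
  Submodule.subset_span ⟨l, rfl, rfl⟩

theorem gen_mem (g : G) : gen deg g ∈ homog deg (deg g) := by
  simpa using prod_mem (deg := deg) [g]

theorem mul_mem {p q : ℕ} {x y : FreeGC deg} (hx : x ∈ homog deg p) (hy : y ∈ homog deg q) :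
    x * y ∈ homog deg (p + q) := by
  have h : homog deg p * homog deg q ≤ homog deg (p + q) := by
    rw [homog, homog, Submodule.span_mul_span]
    refine Submodule.span_le.2 ?_
    rintro _ ⟨_, ⟨l, rfl, rfl⟩, _, ⟨m, rfl, rfl⟩, rfl⟩
    have := prod_mem (deg := deg) (l ++ m)
    simpa using this
  exact h (Submodule.mul_mem_mul hx hy)

theorem gen_mul_prod (g : G) (l : List G) : gen deg g * (l.map (gen deg)).prod =
    ((-1 : ℝ) ^ (deg g * (l.map deg).sum)) • ((l.map (gen deg)).prod * gen deg g) := by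
  induction l with
  | nil => simp
  | cons h l ih =>
    simp only [List.map_cons, List.prod_cons, List.sum_cons]
    rw [← mul_assoc, gen_comm, smul_mul_assoc, mul_assoc, ih, mul_smul_comm, smul_smul,
      ← pow_add, mul_add, mul_assoc]

theorem gen_mul {p : ℕ} (g : G) {x : FreeGC deg} (hx : x ∈ homog deg p) :
    gen deg g * x = ((-1 : ℝ) ^ (deg g * p)) • (x * gen deg g) := by
  refine Submodule.span_induction (p := fun x _ => gen deg g * x =
    ((-1 : ℝ) ^ (deg g * p)) • (x * gen deg g)) ?_ ?_ ?_ ?_ hx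
  · rintro _ ⟨l, rfl, rfl⟩
    exact gen_mul_prod g l
  · simp
  · intro x y _ _ h1 h2
    rw [mul_add, h1, h2, add_mul, smul_add]
  · intro a x _ h
    rw [mul_smul_comm, h, smul_mul_assoc, smul_comm]

theorem neg_one_pow_sq (k : ℕ) : ((-1 : ℝ) ^ k) * ((-1 : ℝ) ^ k) = 1 := by
  rw [← mul_pow]; simp

theorem mul_gen {p : ℕ} (g : G) {x : FreeGC deg} (hx : x ∈ homog deg p) :
    x * gen deg g = ((-1 : ℝ) ^ (deg g * p)) • (gen deg g * x) := by
  rw [gen_mul g hx, smul_smul, neg_one_pow_sq, one_smul]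

/-- The grading involution `x ↦ (-1)^{|x|} x`. -/
def parity (deg : G → ℕ) : FreeGC deg →ₐ[ℝ] FreeGC deg :=
  lift (fun g => ((-1 : ℝ) ^ deg g) • gen deg g) (by
    intro g h
    simp only [smul_mul_assoc, mul_smul_comm]
    rw [gen_comm g h]
    simp only [smul_smul]
    congr 1
    ring)

theorem parity_of_mem {p : ℕ} {x : FreeGC deg} (hx : x ∈ homog deg p) :
    parity deg x = ((-1 : ℝ) ^ p) • x := by
  refine Submodule.span_induction (p := fun x _ => parity deg x = ((-1 : ℝ) ^ p) • x)
    ?_ ?_ ?_ ?_ hx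
  · rintro _ ⟨l, rfl, rfl⟩
    clear hx
    induction l with
    | nil => simp
    | cons g l ih =>
      simp only [List.map_cons, List.prod_cons, List.sum_cons, map_mul]
      rw [ih, parity, lift_gen, smul_mul_smul_comm, pow_add]
  · simp
  · intro x y _ _ h1 h2
    rw [map_add, h1, h2, smul_add]
  · intro a x _ h
    rw [map_smul, h, smul_comm]

/-- Auxiliary homomorphism `x ↦ !![(-1)^{|x|} x, D x; 0, x]`. -/
def derAux (v : G → FreeGC deg) (hv : ∀ g, v g ∈ homog deg (deg g + 1)) :
    FreeGC deg →ₐ[ℝ] Matrix (Fin 2) (Fin 2) (FreeGC deg) :=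
  lift (fun g => !![parity deg (gen deg g), v g; 0, gen deg g]) (by
    intro g h
    have e1 := mul_gen h (hv g)
    have e2 := gen_mul g (hv h)
    ext i j
    fin_cases i <;> fin_cases j
    · simp [parity, smul_smul, gen_comm g h]
      congr 1
      ring
    · simp only [parity, lift_gen, Matrix.smul_apply, Fin.zero_eta, Fin.mk_one, Matrix.mul_apply,
        Fin.sum_univ_two, Matrix.of_apply, Matrix.cons_val', Matrix.cons_val_zero,
        Matrix.cons_val_one, Matrix.cons_val_fin_one, smul_mul_assoc]
      rw [e1, e2, smul_add, smul_smul, smul_smul, add_comm]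
      have h1 : ((-1 : ℝ) ^ deg h) * ((-1 : ℝ) ^ deg h) = 1 := neg_one_pow_sq _
      have h2 : ((-1 : ℝ) ^ deg g) * ((-1 : ℝ) ^ deg g) = 1 := neg_one_pow_sq _
      rw [add_comm]
      rw [add_comm (_ • (v h * gen deg g))]
      congr 2
      · rw [mul_add, pow_add, mul_one, mul_comm (deg h)]
      · rw [mul_add, pow_add, mul_one, mul_left_comm, h2, mul_one]
    · simp
    · simp [gen_comm g h])

theorem derAux_diag (v : G → FreeGC deg) (hv : ∀ g, v g ∈ homog deg (deg g + 1)) (x : FreeGC deg) :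
    derAux v hv x 0 0 = parity deg x ∧ derAux v hv x 1 0 = 0 ∧ derAux v hv x 1 1 = x := by
  obtain ⟨y, rfl⟩ := RingQuot.mkAlgHom_surjective ℝ (GCRel deg) x
  induction y using FreeAlgebra.induction with
  | grade0 r => simp [Matrix.algebraMap_matrix_apply]
  | grade1 g =>
    change derAux v hv (gen deg g) 0 0 = parity deg (gen deg g) ∧
      derAux v hv (gen deg g) 1 0 = 0 ∧ derAux v hv (gen deg g) 1 1 = gen deg g
    simp [derAux]
  | mul a b ha hb =>
    simp only [map_mul, Matrix.mul_apply, Fin.sum_univ_two]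
    rw [ha.1, ha.2.1, ha.2.2, hb.1, hb.2.1, hb.2.2]
    simp
  | add a b ha hb =>
    simp only [map_add, Matrix.add_apply]
    rw [ha.1, ha.2.1, ha.2.2, hb.1, hb.2.1, hb.2.2]
    simp

/-- The degree-one derivation `D` with prescribed values `v` on the generators. -/
def der (v : G → FreeGC deg) (hv : ∀ g, v g ∈ homog deg (deg g + 1)) :
    FreeGC deg →ₗ[ℝ] FreeGC deg where
  toFun x := derAux v hv x 0 1
  map_add' x y := by simp
  map_smul' a x := by simp

theorem der_gen (v : G → FreeGC deg) (hv : ∀ g, v g ∈ homog deg (deg g + 1)) (g : G) :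
    der v hv (gen deg g) = v g := by
  simp [der, derAux]

/-- The graded Leibniz rule `D (x y) = D x y + (-1)^{|x|} x D y`. -/
theorem der_mul (v : G → FreeGC deg) (hv : ∀ g, v g ∈ homog deg (deg g + 1)) {p : ℕ}
    {x : FreeGC deg} (hx : x ∈ homog deg p) (y : FreeGC deg) :
    der v hv (x * y) = der v hv x * y + ((-1 : ℝ) ^ p) • (x * der v hv y) := by
  have h1 := (derAux_diag v hv x).1
  have h2 := (derAux_diag v hv y).2.2
  simp only [der, LinearMap.coe_mk, AddHom.coe_mk, map_mul, Matrix.mul_apply, Fin.sum_univ_two]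
  rw [h1, h2, parity_of_mem hx, smul_mul_assoc, add_comm]

theorem der_mem (v : G → FreeGC deg) (hv : ∀ g, v g ∈ homog deg (deg g + 1)) {p : ℕ}
    {x : FreeGC deg} (hx : x ∈ homog deg p) : der v hv x ∈ homog deg (p + 1) := by
  refine Submodule.span_induction (p := fun x _ => der v hv x ∈ homog deg (p + 1))
    ?_ ?_ ?_ ?_ hx
  · rintro _ ⟨l, rfl, rfl⟩
    clear hx
    induction l with
    | nil =>
      have : der v hv (1 : FreeGC deg) = 0 := by simp [der]
      simp [this]
    | cons g l ih =>
      simp only [List.map_cons, List.prod_cons, List.sum_cons]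
      rw [der_mul v hv (gen_mem g), der_gen]
      refine Submodule.add_mem _ ?_ (Submodule.smul_mem _ _ ?_)
      · have := mul_mem (hv g) (prod_mem (deg := deg) l)
        rwa [add_right_comm] at this
      · have := mul_mem (gen_mem (deg := deg) g) ih
        rwa [← add_assoc] at this
  · simp
  · intro x y _ _ h1 h2
    rw [map_add]
    exact Submodule.add_mem _ h1 h2
  · intro a x _ h
    rw [map_smul]
    exact Submodule.smul_mem _ _ h

end FreeGC

/-! ## `L∞`-algebras, Chevalley--Eilenberg and Weil algebras -/

/-- An `L∞`-algebra `𝔏` over `ℝ` concentrated in non-positive degrees, given dually by its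
Chevalley--Eilenberg algebra `CE(𝔏) = (⊙ 𝔏[1]^*, d_CE)`. The graded vector space `𝔏` has a
homogeneous basis `e_α`, `α : Idx`, and `t^α` denotes the shifted-dual generators, of degree
`deg α = 1 - |e_α| ≥ 1`. The higher brackets are encoded in the structure constants of
`d_CE t^α`: the coefficients of the words of length `k` are, up to sign and a factor `1/k!`, those
of `μ_k`. The homotopy Jacobi identities are the equation `d_CE ∘ d_CE = 0`. -/
structure LInfinityAlgebra where
  /-- The index set of the homogeneous basis. -/
  Idx : Type u
  /-- The degrees `|t^α|`. -/
  deg : Idx → ℕ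
  /-- `𝔏` is concentrated in non-positive degrees. -/
  one_le_deg : ∀ α, 1 ≤ deg α
  /-- The elements `d_CE t^α`. -/
  dgen : Idx → FreeGC deg
  dgen_mem : ∀ α, dgen α ∈ FreeGC.homog deg (deg α + 1)
  sq_zero : ∀ x, FreeGC.der dgen dgen_mem (FreeGC.der dgen dgen_mem x) = 0

namespace LInfinityAlgebra

variable (L : LInfinityAlgebra.{u})

/-- The graded-commutative algebra underlying `CE(𝔏)`. -/
abbrev CE : Type u := FreeGC L.deg

/-- The Chevalley--Eilenberg differential. -/
def dCE : L.CE →ₗ[ℝ] L.CE := FreeGC.der L.dgen L.dgen_mem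

/-- The degrees of the generators of the Weil algebra: `t^α` is `inl α`, and `σ(t^α)`, of degree
`|t^α| + 1`, is `inr α`. -/
def wdeg : L.Idx ⊕ L.Idx → ℕ := Sum.elim L.deg (fun α => L.deg α + 1)

/-- The graded-commutative algebra `⊙ (𝔏[1]^* ⊕ 𝔏[2]^*)` underlying the Weil algebra `W(𝔏)`. -/
abbrev Weil : Type u := FreeGC L.wdeg

/-- The generator `t^α` of the Weil algebra. -/
def t (α : L.Idx) : L.Weil := FreeGC.gen L.wdeg (Sum.inl α)

/-- The generator `σ(t^α)` of the Weil algebra. -/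
def st (α : L.Idx) : L.Weil := FreeGC.gen L.wdeg (Sum.inr α)

/-- The inclusion of graded algebras `⊙ 𝔏[1]^* → ⊙ (𝔏[1]^* ⊕ 𝔏[2]^*)`. -/
def incl : L.CE →ₐ[ℝ] L.Weil :=
  FreeGC.lift L.t (fun α β => FreeGC.gen_comm (deg := L.wdeg) (Sum.inl α) (Sum.inl β))

/-- The projection `W(𝔏) → CE(𝔏)` with `t^α ↦ t^α` and `σ(t^α) ↦ 0`. -/
def proj : L.Weil →ₐ[ℝ] L.CE :=
  FreeGC.lift (Sum.elim (FreeGC.gen L.deg) (fun _ => 0)) (by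
    rintro (α | α) (β | β)
    · exact FreeGC.gen_comm (deg := L.deg) α β
    all_goals simp)

theorem incl_mem {p : ℕ} {x : L.CE} (hx : x ∈ FreeGC.homog L.deg p) :
    L.incl x ∈ FreeGC.homog L.wdeg p := by
  refine Submodule.span_induction (p := fun x _ => L.incl x ∈ FreeGC.homog L.wdeg p)
    ?_ ?_ ?_ ?_ hx
  · rintro _ ⟨l, rfl, rfl⟩
    refine Submodule.subset_span ⟨l.map Sum.inl, ?_, ?_⟩
    · rw [List.map_map]
      rfl
    · rw [List.map_map, map_list_prod, List.map_map]
      congr 1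
      refine List.map_congr_left fun α _ => ?_
      exact (FreeGC.lift_gen _ _ α).symm
  · simp
  · intro x y _ _ h1 h2
    rw [map_add]
    exact Submodule.add_mem _ h1 h2
  · intro a x _ h
    rw [map_smul]
    exact Submodule.smul_mem _ _ h

/-- The values `σ(t^α)`, `0` of the shift derivation on generators. -/
def sgen : L.Idx ⊕ L.Idx → L.Weil := Sum.elim L.st (fun _ => 0)

theorem sgen_mem (g : L.Idx ⊕ L.Idx) : L.sgen g ∈ FreeGC.homog L.wdeg (L.wdeg g + 1) := by
  rcases g with α | α
  · exact FreeGC.gen_mem (deg := L.wdeg) (Sum.inr α)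
  · exact Submodule.zero_mem _

/-- The shift isomorphism `σ`, extended to a nilquadratic derivation of degree one on `W(𝔏)`. -/
def shift : L.Weil →ₗ[ℝ] L.Weil := FreeGC.der L.sgen L.sgen_mem

/-- The values of the Weil differential on generators:
`d_W t = d_CE t + σ(t)` and `d_W σ(t) = - σ(d_W t) = - σ(d_CE t)`. -/
def wgen : L.Idx ⊕ L.Idx → L.Weil :=
  Sum.elim (fun α => L.incl (L.dgen α) + L.st α) (fun α => - L.shift (L.incl (L.dgen α)))

theorem wgen_mem (g : L.Idx ⊕ L.Idx) : L.wgen g ∈ FreeGC.homog L.wdeg (L.wdeg g + 1) := by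
  rcases g with α | α
  · exact Submodule.add_mem _ (L.incl_mem (L.dgen_mem α))
      (FreeGC.gen_mem (deg := L.wdeg) (Sum.inr α))
  · exact Submodule.neg_mem _ (FreeGC.der_mem _ _ (L.incl_mem (L.dgen_mem α)))

/-- The Weil differential. -/
def dW : L.Weil →ₗ[ℝ] L.Weil := FreeGC.der L.wgen L.wgen_mem

end LInfinityAlgebra

/-! ## Differential forms on a manifold

The tangent space `TangentSpace (𝓡 d) x` of a manifold `U` modelled on `ℝ^d` is `ℝ^d` by
definition, the identification being the one given by the preferred chart at `x`. -/

section Forms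

/-- The exterior algebra `Λ (ℝ^d)^*`, which is the fibre of `Λ T*U` at every point `x` when `T_x U`
is identified with `ℝ^d` by the preferred chart at `x`. -/
abbrev CotangentExt (d : ℕ) : Type :=
  ExteriorAlgebra ℝ (Module.Dual ℝ (EuclideanSpace ℝ (Fin d)))

/-- The degree-`k` part of `Λ (ℝ^d)^*`. -/
abbrev cotangentGrading (d : ℕ) (k : ℕ) : Submodule ℝ (CotangentExt d) :=
  ⋀[ℝ]^k (Module.Dual ℝ (EuclideanSpace ℝ (Fin d)))

/-- Not necessarily smooth, inhomogeneous differential forms on `U`, i.e. arbitrary sections of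
`Λ T*U`, with the pointwise wedge product as multiplication. -/
abbrev RoughForm (d : ℕ) (U : Type v) : Type v := U → CotangentExt d

/-- Pullback of exterior forms along a linear map. -/
def extPullback {d : ℕ} (f : EuclideanSpace ℝ (Fin d) →L[ℝ] EuclideanSpace ℝ (Fin d)) :
    CotangentExt d →ₐ[ℝ] CotangentExt d :=
  ExteriorAlgebra.map f.toLinearMap.dualMap

/-- The basis `dx^1, …, dx^d` of the dual of `ℝ^d`. -/
def dxBasis (d : ℕ) : Module.Basis (Fin d) ℝ (Module.Dual ℝ (EuclideanSpace ℝ (Fin d))) :=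
  (EuclideanSpace.basisFun (Fin d) ℝ).toBasis.dualBasis

variable {d : ℕ} {U : Type v} [TopologicalSpace U] [ChartedSpace (EuclideanSpace ℝ (Fin d)) U]

/-- The derivative at `p` of the preferred chart at `p`, as a map `T_p U → ℝ^d`. -/
def chartDeriv (p : U) : EuclideanSpace ℝ (Fin d) →L[ℝ] EuclideanSpace ℝ (Fin d) :=
  mfderiv (𝓡 d) 𝓘(ℝ, EuclideanSpace ℝ (Fin d)) (extChartAt (𝓡 d) p) p

/-- The derivative at `y` of the inverse of the preferred chart at `p`, as a map
`ℝ^d → T_q U` where `q` is the point with coordinates `y`. -/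
def chartSymmDeriv (p : U) (y : EuclideanSpace ℝ (Fin d)) :
    EuclideanSpace ℝ (Fin d) →L[ℝ] EuclideanSpace ℝ (Fin d) :=
  mfderiv 𝓘(ℝ, EuclideanSpace ℝ (Fin d)) (𝓡 d) (extChartAt (𝓡 d) p).symm y

/-- The coordinate expression of a form in the preferred chart at `p`: its pullback along the
inverse of the chart. -/
def coordRep (p : U) (η : RoughForm d U) (y : EuclideanSpace ℝ (Fin d)) : CotangentExt d :=
  extPullback (chartSymmDeriv p y) (η ((extChartAt (𝓡 d) p).symm y))

/-- The coefficient of `dx^I` in the coordinate expression of a form in the chart at `p`. -/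
def coordCoeff (p : U) (η : RoughForm d U) (I : Finset (Fin d))
    (y : EuclideanSpace ℝ (Fin d)) : ℝ :=
  (dxBasis d).ExteriorAlgebra.repr (coordRep p η y) I

/-- A form is smooth if its coefficients are smooth in the chart around every point. -/
def IsSmoothForm (η : RoughForm d U) : Prop :=
  ∀ (p : U) (I : Finset (Fin d)),
    ContDiffOn ℝ ∞ (coordCoeff p η I) (extChartAt (𝓡 d) p).target

/-- The exterior derivative, computed at the point `p` in the chart at `p`:
`d (∑ f_I dx^I) = ∑ ∂_j f_I dx^j ∧ dx^I`. -/
def extD (η : RoughForm d U) : RoughForm d U := fun p =>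
  extPullback (chartDeriv p)
    (∑ I : Finset (Fin d), ∑ j : Fin d,
      fderiv ℝ (coordCoeff p η I) (extChartAt (𝓡 d) p p) (EuclideanSpace.basisFun (Fin d) ℝ j) •
        (ExteriorAlgebra.ι ℝ (dxBasis d j) * (dxBasis d).ExteriorAlgebra I))

/-- `η` is a smooth `k`-form, i.e. an element of `Ω^k(U)`. -/
def IsForm (k : ℕ) (η : RoughForm d U) : Prop :=
  IsSmoothForm η ∧ ∀ x, η x ∈ cotangentGrading d k

/-- The fibre of the graded tensor product of the bundle `Λ T*U` with a graded algebra of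
parameters (ghosts) `B`. -/
abbrev GhostFibre (d : ℕ) {B : Type u} [Ring B] [Algebra ℝ B] (ℬ : ℕ → Submodule ℝ B)
    [GradedAlgebra ℬ] : Type u :=
  GradedTensorProduct ℝ (cotangentGrading d) ℬ

/-- The subspace `Ω^k(U) ⊗ B_j` of forms of form degree `k` and ghost degree `j`. -/
def ghostForms (d : ℕ) (U : Type v) [TopologicalSpace U]
    [ChartedSpace (EuclideanSpace ℝ (Fin d)) U] {B : Type u} [Ring B] [Algebra ℝ B]
    (ℬ : ℕ → Submodule ℝ B) [GradedAlgebra ℬ] (k j : ℕ) :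
    Submodule ℝ (U → GhostFibre d ℬ) :=
  Submodule.span ℝ {s | ∃ (η : RoughForm d U) (b : B), IsForm k η ∧ b ∈ ℬ j ∧
    s = fun x => GradedTensorProduct.tmul ℝ (η x) b}

end Forms

/-! ## Adjustments and adjusted connections -/

namespace LInfinityAlgebra

variable (L : LInfinityAlgebra.{u})

/-- A graded algebra automorphism `φ` of the Weil algebra, with `φ(t) = t`, covering the identity
on the Chevalley--Eilenberg algebra. It need not commute with the Weil differential. -/
structure WeilAut where
  toAlgEquiv : L.Weil ≃ₐ[ℝ] L.Weil
  map_homog : ∀ p, ∀ x ∈ FreeGC.homog L.wdeg p, toAlgEquiv x ∈ FreeGC.homog L.wdeg p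
  map_t : ∀ α, toAlgEquiv (L.t α) = L.t α
  covers_id : ∀ x, L.proj (toAlgEquiv x) = L.proj x

variable {L}

/-- The automorphism `φ` is an adjustment: setting the curvature ghosts to zero is compatible with
the BRST differential.

An element of the inner hom, with values in a graded-commutative algebra `B` of parameters graded by
ghost degree, is a morphism of graded algebras `𝒜 : W(𝔏) → Ω(U) ⊗ B`, that is,
`𝒜(t^α) = A^α + ∑_{0 < j ≤ |t^α|} c^α_j` with `c^α_j` of form degree `|t^α| - j` and ghost
degree `j`. The curvature ghosts vanish if `𝒜(φ(σ(t^α))) = F^α` has ghost degree zero. The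
BRST differential of the curvature ghost of ghost degree `j ≥ 1` is then, up to sign, the
part `R_{j+1}` of ghost degree `j + 1` of `𝒜(d_W φ(σ(t^α)))`, which is of total degree
`|t^α| + 2`. All of these have to vanish, i.e. only ghost degrees `0` and `1` may occur. This is
required for all contractible manifolds `U` and all parameter algebras `B`. -/
def WeilAut.IsAdjustment (φ : L.WeilAut) : Prop :=
  ∀ (d : ℕ) (U : Type) [TopologicalSpace U] [ChartedSpace (EuclideanSpace ℝ (Fin d)) U]
    [IsManifold (𝓡 d) ∞ U] [T2Space U] [SecondCountableTopology U] [ContractibleSpace U]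
    (B : Type u) [Ring B] [Algebra ℝ B] (ℬ : ℕ → Submodule ℝ B) [GradedAlgebra ℬ],
    (∀ i j, ∀ a ∈ ℬ i, ∀ b ∈ ℬ j, a * b = ((-1 : ℝ) ^ (i * j)) • (b * a)) →
    ∀ 𝒜 : L.Weil →ₐ[ℝ] (U → GhostFibre d ℬ),
      (∀ α, 𝒜 (L.t α) ∈ ⨆ j ∈ Finset.range (L.deg α + 1), ghostForms d U ℬ (L.deg α - j) j) →
      (∀ α, 𝒜 (φ.toAlgEquiv (L.st α)) ∈ ghostForms d U ℬ (L.deg α + 1) 0) →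
      ∀ α, 𝒜 (L.dW (φ.toAlgEquiv (L.st α))) ∈
        ghostForms d U ℬ (L.deg α + 2) 0 ⊔ ghostForms d U ℬ (L.deg α + 1) 1

variable (L) in
/-- An `𝔏`-valued connection on `U`: a morphism of differential graded algebras
`𝒜 : W(𝔏) → (Ω(U), d)`. -/
structure Connection (d : ℕ) (U : Type v) [TopologicalSpace U]
    [ChartedSpace (EuclideanSpace ℝ (Fin d)) U] where
  toAlgHom : L.Weil →ₐ[ℝ] RoughForm d U
  isForm : ∀ p, ∀ w ∈ FreeGC.homog L.wdeg p, IsForm p (toAlgHom w)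
  map_d : ∀ w, toAlgHom (L.dW w) = extD (toAlgHom w)

namespace Connection

variable {d : ℕ} {U : Type v} [TopologicalSpace U] [ChartedSpace (EuclideanSpace ℝ (Fin d)) U]

/-- The gauge potentials `A^α = 𝒜(t^α)`, which are `|t^α|`-forms. -/
def potential (𝒜 : L.Connection d U) (α : L.Idx) : RoughForm d U :=
  𝒜.toAlgHom (L.t α)

/-- The adjusted curvatures `F^α = 𝒜(φ(σ(t^α)))`, which are `(|t^α| + 1)`-forms. -/
def curvature (𝒜 : L.Connection d U) (φ : L.WeilAut) (α : L.Idx) : RoughForm d U :=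
  𝒜.toAlgHom (φ.toAlgEquiv (L.st α))

end Connection

end LInfinityAlgebra

end

/-!
Let `P^α = φ⁻¹ (d_W φ(σ(t^α)))` (`WeilAut.bianchi`), the polynomial that expresses `d_W φ(σ(t^α))`
by `t` and `φ(σ(t))`, with `σ(t)` as placeholder for `φ(σ(t))`. Since a connection is a morphism of
differential graded algebras, the Bianchi identity for `F^α` is the image of this expression, and
the theorem says that `P^α` has at most one factor `t^β` in each term, of degree one, and at least
one factor `σ(t^γ)`. As `P^α` is homogeneous of degree `|t^α| + 2 ≥ 3`, it is enough that only words
occur whose letters `t` have total degree at most one (`word_mem_span_sup_span`).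

This is tested on `U = ℝ^d`, with an exterior algebra of ghosts, by homomorphisms sending every
`t^β` to a pure ghost of ghost degree `|t^β|` and every `φ(σ(t^γ))` to a constant form of ghost
degree zero (`testHom`). The ghost degree of the image of a word is the total degree of its
letters `t`, so the adjustment condition kills the images of all parts of `P^α` in which this is at
least two (`WeilAut.IsAdjustment.testHom_bianchi_mem`). Rescaling the generators by real parameters
and comparing coefficients of polynomials isolates the part of `P^α` with given letters
(`sum_filter_eq_zero_of_forall_sum_prod_smul_eq_zero`), which is a multiple of a single word. It
remains to see that a nonzero word has a nonzero image for suitable ghosts and forms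
(`exists_testHom_ne_zero`). This reduces to the statement that a nonzero word in a free
graded-commutative algebra has a nonzero specialization in an exterior algebra of high dimension
(`FreeGC.exists_exterior_prod_ne_zero`).
-/

noncomputable section

/-! ### Graded commutativity and nonvanishing products in the exterior algebra -/

namespace ExteriorAlgebra

variable {M : Type*} [AddCommGroup M] [Module ℝ M]

theorem ι_mul_of_mem_exteriorPower (v : M) {n : ℕ} {y : ExteriorAlgebra ℝ M} (hy : y ∈ ⋀[ℝ]^n M) :
    ι ℝ v * y = ((-1 : ℝ) ^ n) • (y * ι ℝ v) := by
  induction hy using Submodule.pow_induction_on_left' with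
  | algebraMap r => simp [Algebra.commutes]
  | add x y i _ _ hx hy => rw [mul_add, hx, hy, add_mul, smul_add]
  | mem_mul m hm i x _ ih =>
    obtain ⟨w, rfl⟩ := hm
    have h : ι ℝ v * ι ℝ w = -(ι ℝ w * ι ℝ v) := eq_neg_of_add_eq_zero_left (ι_add_mul_swap v w)
    rw [← mul_assoc, h, neg_mul, mul_assoc, ih, mul_smul_comm, mul_assoc, pow_succ, mul_neg_one,
      neg_smul]

/-- The exterior algebra is graded commutative. -/
theorem mul_comm_of_mem_exteriorPower {m n : ℕ} {x y : ExteriorAlgebra ℝ M} (hx : x ∈ ⋀[ℝ]^m M)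
    (hy : y ∈ ⋀[ℝ]^n M) : x * y = ((-1 : ℝ) ^ (m * n)) • (y * x) := by
  induction hx using Submodule.pow_induction_on_left' with
  | algebraMap r => simp [Algebra.commutes]
  | add x x' i _ _ hx hx' => rw [add_mul, hx, hx', mul_add, smul_add]
  | mem_mul w hw i x _ ih =>
    obtain ⟨v, rfl⟩ := hw
    rw [mul_assoc, ih, mul_smul_comm, ← mul_assoc, ι_mul_of_mem_exteriorPower v hy,
      smul_mul_assoc, smul_smul, mul_assoc, ← pow_add, Nat.succ_mul]

/-- The subalgebra generated by the first `n` vectors of a sequence. -/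
def flag (e : ℕ → M) (n : ℕ) : Subalgebra ℝ (ExteriorAlgebra ℝ M) :=
  Algebra.adjoin ℝ ((fun i => ι ℝ (e i)) '' Set.Iio n)

theorem flag_mono (e : ℕ → M) {m n : ℕ} (h : m ≤ n) : flag e m ≤ flag e n :=
  Algebra.adjoin_mono (Set.image_mono (Set.Iio_subset_Iio h))

theorem ι_mem_flag (e : ℕ → M) {i n : ℕ} (h : i < n) : ι ℝ (e i) ∈ flag e n :=
  Algebra.subset_adjoin ⟨i, h, rfl⟩

/-- A functional vanishing on the first `n` vectors contracts to zero with everything that these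
vectors generate. -/
theorem contractLeft_eq_zero_of_mem_flag {e : ℕ → M} {n : ℕ} (D : Module.Dual ℝ M)
    (hD : ∀ i < n, D (e i) = 0) {y : ExteriorAlgebra ℝ M} (hy : y ∈ flag e n) :
    CliffordAlgebra.contractLeft D y = 0 := by
  -- Stronger: left multiplication by `y` preserves the kernel of the contraction. This form passes
  -- to products `y * y'` without a Leibniz rule for the contraction of a product.
  have key : ∀ z : ExteriorAlgebra ℝ M, CliffordAlgebra.contractLeft D z = 0 →
      CliffordAlgebra.contractLeft D (y * z) = 0 := by
    induction hy using Algebra.adjoin_induction with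
    | mem x hx =>
      obtain ⟨i, hi, rfl⟩ := hx
      intro z hz
      have := CliffordAlgebra.contractLeft_ι_mul (Q := (0 : QuadraticForm ℝ M)) (d := D) (e i) z
      rw [hz, hD i hi, zero_smul, mul_zero, sub_zero] at this
      exact this
    | algebraMap r =>
      intro z hz
      have := CliffordAlgebra.contractLeft_algebraMap_mul (Q := (0 : QuadraticForm ℝ M))
        (d := D) r z
      rw [hz, mul_zero] at this
      exact this
    | add x y _ _ hx hy =>
      intro z hz
      rw [add_mul, map_add, hx z hz, hy z hz, add_zero]
    | mul x y _ _ hx hy =>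
      intro z hz
      rw [mul_assoc]
      exact hx _ (hy z hz)
  have := key 1 (CliffordAlgebra.contractLeft_one (Q := (0 : QuadraticForm ℝ M)) (d := D))
  rwa [mul_one] at this

/-- The product `e_{s+k-1} ∧ … ∧ e_{s+1} ∧ e_s`. -/
def block (e : ℕ → M) (s : ℕ) : ℕ → ExteriorAlgebra ℝ M
  | 0 => 1
  | k + 1 => ι ℝ (e (s + k)) * block e s k

theorem block_mem_exteriorPower (e : ℕ → M) (s k : ℕ) : block e s k ∈ ⋀[ℝ]^k M := by
  induction k with
  | zero => simp [block]
  | succ k ih =>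
    rw [block, exteriorPower, pow_succ']
    exact Submodule.mul_mem_mul (LinearMap.mem_range_self _ _) ih

theorem block_mem_flag (e : ℕ → M) (s k : ℕ) : block e s k ∈ flag e (s + k) := by
  induction k with
  | zero => exact one_mem _
  | succ k ih =>
    exact mul_mem (ι_mem_flag e (by omega)) (flag_mono e (by omega) ih)

theorem block_mul_self (e : ℕ → M) (s : ℕ) {k : ℕ} (hk : 1 ≤ k) :
    block e s k * block e s k = 0 := by
  obtain ⟨k, rfl⟩ := Nat.exists_eq_add_of_le' hk
  have h := ι_mul_of_mem_exteriorPower (e (s + k)) (block_mem_exteriorPower e s k)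
  rw [block]
  nth_rewrite 1 [h]
  rw [smul_mul_assoc, mul_assoc, ← mul_assoc (ι ℝ (e (s + k))), ι_sq_zero, zero_mul, mul_zero,
    smul_zero]

/-- Contracting with the functionals dual to the vectors of the block recovers `y`. -/
theorem block_mul_ne_zero {e : ℕ → M} {D : ℕ → Module.Dual ℝ M} {s k : ℕ}
    (h1 : ∀ i < s + k, D i (e i) = 1) (h0 : ∀ i < s + k, ∀ j < i, D i (e j) = 0)
    {y : ExteriorAlgebra ℝ M} (hy : y ∈ flag e s) (hy0 : y ≠ 0) : block e s k * y ≠ 0 := by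
  induction k with
  | zero => simpa [block] using hy0
  | succ k ih =>
    have hk := ih (fun i hi => h1 i (by omega)) (fun i hi => h0 i (by omega))
    intro h
    have hmem : block e s k * y ∈ flag e (s + k) :=
      mul_mem (block_mem_flag e s k) (flag_mono e (by omega) hy)
    have h2 := contractLeft_eq_zero_of_mem_flag (D (s + k)) (h0 (s + k) (by omega)) hmem
    have h3 := CliffordAlgebra.contractLeft_ι_mul (Q := (0 : QuadraticForm ℝ M))
      (d := D (s + k)) (e (s + k)) (block e s k * y)
    rw [h2, h1 (s + k) (by omega), mul_zero, one_smul, sub_zero] at h3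
    rw [block, mul_assoc] at h
    refine hk (h3.symm.trans ?_)
    have h4 : CliffordAlgebra.ι (0 : QuadraticForm ℝ M) (e (s + k)) * (block e s k * y) = 0 := h
    rw [h4, map_zero]

end ExteriorAlgebra

/-- Replacing one factor `y = f g` by `y + θ`, with `θ² = 0`, in a product of commuting quantities
changes it by `θ` times the derivative of the product with respect to `y`. -/
theorem exists_prod_update_eq {R G : Type*} [Ring R] [DecidableEq G] (f : G → R) (g : G) (θ : R)
    (hθ : θ * θ = 0) (hθf : ∀ h, Commute θ (f h)) (hg : ∀ h, Commute (f g) (f h)) (l : List G) :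
    ∃ E, (l.map (Function.update f g (f g + θ))).prod = (l.map f).prod + θ * E ∧
      f g * E = l.count g • (l.map f).prod := by
  induction l with
  | nil => exact ⟨0, by simp, by simp⟩
  | cons h l ih =>
    obtain ⟨E, h1, h2⟩ := ih
    by_cases hh : h = g
    · subst hh
      refine ⟨(l.map f).prod + f h * E, ?_, ?_⟩
      · simp only [List.map_cons, List.prod_cons, Function.update_self, h1]
        have e1 : f h * (θ * E) = θ * (f h * E) := by
          rw [← mul_assoc, ← (hθf h).eq, mul_assoc]
        have e2 : θ * (θ * E) = 0 := by rw [← mul_assoc, hθ, zero_mul]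
        rw [mul_add, add_mul, add_mul, e1, e2, mul_add]
        abel
      · simp only [List.map_cons, List.prod_cons, List.count_cons_self, h2, mul_add,
          mul_smul_comm, add_smul, one_smul]
        abel
    · refine ⟨f h * E, ?_, ?_⟩
      · simp only [List.map_cons, List.prod_cons, Function.update_of_ne hh, h1]
        rw [mul_add, ← mul_assoc (f h) θ, ← (hθf h).eq, mul_assoc]
      · rw [← mul_assoc, (hg h).eq, mul_assoc, h2, List.count_cons_of_ne hh, List.map_cons,
          List.prod_cons, mul_smul_comm]

namespace FreeGC

variable {G : Type*} {deg : G → ℕ}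

theorem gen_mul_self {g : G} (hg : Odd (deg g)) : gen deg g * gen deg g = 0 := by
  -- stated for a general module, so that the additive structure of `RingQuot` need not be unfolded
  have aux : ∀ {A : Type _} [AddCommGroup A] [Module ℝ A] (x : A), x = (-1 : ℝ) • x → x = 0 := by
    intro A _ _ x hx
    rw [neg_smul, one_smul] at hx
    have h2 : (2 : ℝ) • x = 0 := by
      rw [two_smul]
      nth_rewrite 1 [hx]
      exact neg_add_cancel _
    exact (smul_eq_zero.1 h2).resolve_left two_ne_zero
  have h := gen_comm (deg := deg) g g
  rw [(hg.mul hg).neg_one_pow] at h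
  exact aux _ h

/-- Permuting the letters of a word changes it by a sign. -/
theorem exists_prod_eq_smul_of_perm {l m : List G} (h : l.Perm m) :
    ∃ c : ℝ, c ≠ 0 ∧ (l.map (gen deg)).prod = c • (m.map (gen deg)).prod := by
  induction h with
  | nil => exact ⟨1, one_ne_zero, by simp⟩
  | cons g _ ih =>
    obtain ⟨c, hc, h⟩ := ih
    exact ⟨c, hc, by simp [h]⟩
  | swap g h l =>
    refine ⟨(-1) ^ (deg h * deg g), pow_ne_zero _ (by norm_num), ?_⟩
    simp only [List.map_cons, List.prod_cons]
    rw [← mul_assoc, gen_comm, smul_mul_assoc, mul_assoc]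
  | trans _ _ ih1 ih2 =>
    obtain ⟨c, hc, h⟩ := ih1
    obtain ⟨d, hd, h'⟩ := ih2
    exact ⟨c * d, mul_ne_zero hc hd, by rw [h, h', smul_smul]⟩

theorem gen_mul_prod_eq_zero_of_mem {g : G} (hg : Odd (deg g)) {l : List G} (h : g ∈ l) :
    gen deg g * (l.map (gen deg)).prod = 0 := by
  classical
  obtain ⟨c, -, hc⟩ := exists_prod_eq_smul_of_perm (deg := deg) (List.perm_cons_erase h)
  rw [hc, List.map_cons, List.prod_cons, mul_smul_comm, ← mul_assoc, gen_mul_self hg, zero_mul,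
    smul_zero]

open ExteriorAlgebra in
/-- A nonzero word in a free graded-commutative algebra on generators of positive degree stays
nonzero under a suitable grading-preserving specialization of the generators in an exterior algebra
on enough linearly independent vectors. By induction on the length, a new letter `g` is specialized
to its old value, or to that value plus a product `θ` of `deg g` new vectors if the former makes the
word vanish: the coefficient of `θ` is the value of the shorter word times the multiplicity
of `g`. -/
theorem exists_exterior_prod_ne_zero {M : Type*} [AddCommGroup M] [Module ℝ M] {e : ℕ → M}
    {D : ℕ → Module.Dual ℝ M} {N : ℕ} (h1 : ∀ i < N, D i (e i) = 1)
    (h0 : ∀ i < N, ∀ j < i, D i (e j) = 0) (hdeg : ∀ g, 1 ≤ deg g) (l : List G)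
    (hl : (l.map (gen deg)).prod ≠ 0) (hN : (l.map deg).sum ≤ N) :
    ∃ f : G → ExteriorAlgebra ℝ M, (∀ g, f g ∈ ⋀[ℝ]^(deg g) M) ∧
      (∀ g, f g ∈ flag e (l.map deg).sum) ∧ (l.map f).prod ≠ 0 := by
  classical
  induction l with
  | nil =>
    refine ⟨0, fun _ => Submodule.zero_mem _, fun _ => zero_mem _, ?_⟩
    have : Nontrivial (ExteriorAlgebra ℝ M) := inferInstance
    simp
  | cons g l ih =>
    rw [List.map_cons, List.prod_cons] at hl
    rw [List.map_cons, List.sum_cons] at hN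
    obtain ⟨f, hf, hfs, hfl⟩ := ih (fun h => hl (by rw [h, mul_zero])) (by omega)
    set s := (l.map deg).sum with hs
    have hsum : ((g :: l).map deg).sum = s + deg g := by simp [hs, add_comm]
    rw [hsum]
    have hfs' : ∀ h, f h ∈ flag e (s + deg g) := fun h => flag_mono e (by omega) (hfs h)
    by_cases ha : ((g :: l).map f).prod = 0
    swap
    · exact ⟨f, hf, hfs', ha⟩
    set θ := block e s (deg g) with hθ
    have hθm : θ ∈ ⋀[ℝ]^(deg g) M := block_mem_exteriorPower e s _
    have hne : θ * (l.map f).prod ≠ 0 := by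
      refine block_mul_ne_zero (D := D) (fun i hi => h1 i (by omega))
        (fun i hi => h0 i (by omega)) ?_ hfl
      refine Subalgebra.list_prod_mem _ fun x hx => ?_
      obtain ⟨h, -, rfl⟩ := List.mem_map.1 hx
      exact hfs h
    refine ⟨Function.update f g (f g + θ), fun h => ?_, fun h => ?_, ?_⟩
    · by_cases hh : h = g
      · subst hh
        rw [Function.update_self]
        exact Submodule.add_mem _ (hf h) hθm
      · rw [Function.update_of_ne hh]
        exact hf h
    · by_cases hh : h = g
      · subst hh
        rw [Function.update_self]
        exact add_mem (hfs' h) (block_mem_flag e s _)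
      · rw [Function.update_of_ne hh]
        exact hfs' h
    · rw [List.map_cons, List.prod_cons] at ha
      rw [List.map_cons, List.prod_cons, Function.update_self]
      rcases Nat.even_or_odd (deg g) with hg | hg
      · have hc : ∀ {x}, x ∈ ⋀[ℝ]^(deg g) M → ∀ h, Commute x (f h) := fun hx h => by
          have := mul_comm_of_mem_exteriorPower hx (hf h)
          rwa [(hg.mul_right _).neg_one_pow, one_smul] at this
        have hsq : θ * θ = 0 := block_mul_self e s (hdeg g)
        obtain ⟨E, hE, hE'⟩ := exists_prod_update_eq f g θ hsq (hc hθm) (hc (hf g)) l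
        have e1 : f g * (θ * E) = l.count g • (θ * (l.map f).prod) := by
          rw [← mul_assoc, ← (hc hθm g).eq, mul_assoc, hE', mul_smul_comm]
        have e2 : θ * (θ * E) = 0 := by rw [← mul_assoc, hsq, zero_mul]
        rw [hE, mul_add, add_mul, add_mul, ha, e1, e2, zero_add, add_zero, ← succ_nsmul',
          ← Nat.cast_smul_eq_nsmul ℝ]
        exact smul_ne_zero (Nat.cast_ne_zero.2 (Nat.succ_ne_zero _)) hne
      · have hgl : g ∉ l := fun h => hl (gen_mul_prod_eq_zero_of_mem hg h)
        have : l.map (Function.update f g (f g + θ)) = l.map f :=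
          List.map_congr_left fun h hh =>
            Function.update_of_ne (by rintro rfl; exact hgl hh) _ _
        rw [this, add_mul, ha, zero_add]
        exact hne

end FreeGC

/-! ### Words in free graded-commutative algebras -/

namespace FreeGC

variable {G : Type*} {deg : G → ℕ}

theorem span_words : Submodule.span ℝ (Set.range fun l : List G => (l.map (gen deg)).prod) = ⊤ := by
  set S := Submodule.span ℝ (Set.range fun l : List G => (l.map (gen deg)).prod) with hS
  have hw : ∀ l : List G, (l.map (gen deg)).prod ∈ S := fun l => Submodule.subset_span ⟨l, rfl⟩
  have hmul : S * S ≤ S := by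
    conv_lhs => rw [hS]
    rw [Submodule.span_mul_span]
    refine Submodule.span_le.2 ?_
    rintro _ ⟨_, ⟨l, rfl⟩, _, ⟨m, rfl⟩, rfl⟩
    have := hw (l ++ m)
    rwa [List.map_append, List.prod_append] at this
  refine Submodule.eq_top_iff'.2 fun x => ?_
  obtain ⟨y, rfl⟩ := RingQuot.mkAlgHom_surjective ℝ (GCRel deg) x
  induction y using FreeAlgebra.induction with
  | grade0 r =>
    rw [AlgHom.commutes, Algebra.algebraMap_eq_smul_one]
    exact S.smul_mem r (by simpa using hw [])
  | grade1 g =>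
    have := hw [g]
    rwa [List.map_singleton, List.prod_singleton] at this
  | mul a b ha hb =>
    rw [map_mul]
    exact hmul (Submodule.mul_mem_mul ha hb)
  | add a b ha hb =>
    rw [map_add]
    exact S.add_mem ha hb

/-- The homomorphism `x ↦ ∑ p, xₚ Xᵖ`, where `xₚ` is the component of degree `p` of `x`. -/
def gradingHom (deg : G → ℕ) : FreeGC deg →ₐ[ℝ] Polynomial (FreeGC deg) :=
  lift (fun g => Polynomial.monomial (deg g) (gen deg g)) (by
    intro g h
    rw [Polynomial.monomial_mul_monomial, Polynomial.monomial_mul_monomial, gen_comm g h,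
      Polynomial.smul_monomial, add_comm])

/-- The component of degree `p`. -/
def component (deg : G → ℕ) (p : ℕ) (x : FreeGC deg) : FreeGC deg :=
  (gradingHom deg x).coeff p

theorem component_add (p : ℕ) (x y : FreeGC deg) :
    component deg p (x + y) = component deg p x + component deg p y := by
  simp [component]

theorem component_smul (p : ℕ) (a : ℝ) (x : FreeGC deg) :
    component deg p (a • x) = a • component deg p x := by
  simp [component]

theorem gradingHom_of_mem {p : ℕ} {x : FreeGC deg} (hx : x ∈ homog deg p) :
    gradingHom deg x = Polynomial.monomial p x := by
  refine Submodule.span_induction (p := fun x _ => gradingHom deg x = Polynomial.monomial p x)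
    ?_ ?_ ?_ ?_ hx
  · rintro _ ⟨l, rfl, rfl⟩
    clear hx
    induction l with
    | nil => simp
    | cons g l ih =>
      simp only [List.map_cons, List.prod_cons, List.sum_cons, map_mul]
      rw [ih, gradingHom, lift_gen, Polynomial.monomial_mul_monomial]
  · simp
  · intro x y _ _ h1 h2
    rw [map_add, h1, h2, map_add]
  · intro a x _ h
    rw [map_smul, h, Polynomial.smul_monomial]

theorem component_of_mem {p q : ℕ} {x : FreeGC deg} (hx : x ∈ homog deg q) :
    component deg p x = if q = p then x else 0 := by
  rw [component, gradingHom_of_mem hx, Polynomial.coeff_monomial]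

theorem component_mem (p : ℕ) (x : FreeGC deg) : component deg p x ∈ homog deg p := by
  have hx : x ∈ Submodule.span ℝ (Set.range fun l : List G => (l.map (gen deg)).prod) := by
    rw [span_words]; trivial
  induction hx using Submodule.span_induction with
  | mem x hx =>
    obtain ⟨l, rfl⟩ := hx
    rw [component_of_mem (prod_mem l)]
    split_ifs with h
    · exact h ▸ prod_mem l
    · exact Submodule.zero_mem _
  | zero => simp [component]
  | add x y _ _ hx hy => rw [component_add]; exact Submodule.add_mem _ hx hy
  | smul a x _ hx => rw [component_smul]; exact Submodule.smul_mem _ _ hx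

/-- An injective linear map that preserves degrees also reflects them. -/
theorem mem_homog_of_map_mem (f : FreeGC deg →ₗ[ℝ] FreeGC deg) (hf : Function.Injective f)
    (h : ∀ p, ∀ x ∈ homog deg p, f x ∈ homog deg p) {p : ℕ} {x : FreeGC deg}
    (hx : f x ∈ homog deg p) : x ∈ homog deg p := by
  have key : ∀ x, f (component deg p x) = component deg p (f x) := by
    intro x
    have hx : x ∈ Submodule.span ℝ (Set.range fun l : List G => (l.map (gen deg)).prod) := by
      rw [span_words]; trivial
    induction hx using Submodule.span_induction with
    | mem x hx =>
      obtain ⟨l, rfl⟩ := hx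
      rw [component_of_mem (prod_mem l), component_of_mem (h _ _ (prod_mem l))]
      split_ifs
      · rfl
      · exact map_zero f
    | zero => simp [component]
    | add x y _ _ hx hy => rw [component_add, map_add, hx, hy, map_add, component_add]
    | smul a x _ hx => rw [component_smul, map_smul, hx, map_smul, component_smul]
  have h1 := key x
  rw [component_of_mem hx, if_pos rfl] at h1
  rw [← hf h1]
  exact component_mem p x

end FreeGC

/-- If a linear combination of vectors with the monomials `∏_{g ∈ w} x g` as coefficients vanishes
for all real values of the variables, then so does the part belonging to each single monomial. -/
theorem sum_filter_eq_zero_of_forall_sum_prod_smul_eq_zero {G V : Type*} [DecidableEq G]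
    [AddCommGroup V] [Module ℝ V] (T : Finset (List G)) (v : List G → V)
    (h : ∀ x : G → ℝ, ∑ w ∈ T, (w.map x).prod • v w = 0) (μ : Multiset G) :
    ∑ w ∈ T with Multiset.ofList w = μ, v w = 0 := by
  refine (Module.forall_dual_apply_eq_zero_iff ℝ _).1 fun f => ?_
  set q : MvPolynomial G ℝ :=
    ∑ w ∈ T, MvPolynomial.monomial (Multiset.toFinsupp (w : Multiset G)) (f (v w)) with hq
  have hq0 : q = 0 := by
    refine MvPolynomial.funext fun x => ?_
    have hx := congrArg f (h x)
    rw [map_sum, map_zero] at hx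
    rw [map_zero, hq, map_sum, ← hx]
    refine Finset.sum_congr rfl fun w _ => ?_
    rw [MvPolynomial.eval_monomial, map_smul, smul_eq_mul, mul_comm]
    congr 1
    rw [Finsupp.prod, Multiset.toFinsupp_support, ← Multiset.prod_coe, ← Multiset.map_coe,
      Finset.prod_multiset_map_count]
    rfl
  have hc := congrArg (MvPolynomial.coeff (Multiset.toFinsupp μ)) hq0
  rw [hq, MvPolynomial.coeff_sum, MvPolynomial.coeff_zero] at hc
  rw [map_sum, Finset.sum_filter]
  refine Eq.trans ?_ hc
  refine Finset.sum_congr rfl fun w _ => ?_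
  rw [MvPolynomial.coeff_monomial]
  simp only [EmbeddingLike.apply_eq_iff_eq]

namespace LInfinityAlgebra

variable (L : LInfinityAlgebra.{u})

theorem one_le_wdeg (g : L.Idx ⊕ L.Idx) : 1 ≤ L.wdeg g := by
  rcases g with α | α
  · exact L.one_le_deg α
  · exact Nat.le_add_left _ _

/-- The total degree of the letters `t^α` in a word, i.e. its ghost degree if all `t^α` are
specialized to pure ghosts. -/
def tdeg (w : List (L.Idx ⊕ L.Idx)) : ℕ := (w.map (Sum.elim L.deg 0)).sum

/-- Every word can be sorted into letters `σ(t^α)` followed by letters `t^α`. -/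
theorem exists_perm (w : List (L.Idx ⊕ L.Idx)) :
    ∃ m l : List L.Idx, w.Perm (m.map Sum.inr ++ l.map Sum.inl) := by
  induction w with
  | nil => exact ⟨[], [], by simp⟩
  | cons g w ih =>
    obtain ⟨m, l, h⟩ := ih
    rcases g with α | α
    · refine ⟨m, α :: l, (h.cons _).trans ?_⟩
      rw [List.map_cons]
      exact List.perm_middle.symm
    · exact ⟨α :: m, l, h.cons _⟩

theorem tdeg_perm {w w' : List (L.Idx ⊕ L.Idx)} (h : w.Perm w') : L.tdeg w = L.tdeg w' :=
  (h.map _).sum_eq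

theorem tdeg_append (m l : List L.Idx) :
    L.tdeg (m.map Sum.inr ++ l.map Sum.inl) = (l.map L.deg).sum := by
  simp [tdeg, Function.comp_def]

end LInfinityAlgebra

/-! ### Constant differential forms on Euclidean space -/

theorem isForm_const {d k : ℕ} {η : CotangentExt d} (h : η ∈ cotangentGrading d k) :
    IsForm (U := EuclideanSpace ℝ (Fin d)) k (fun _ => η) := by
  refine ⟨fun p I => ?_, fun _ => h⟩
  have hc : coordCoeff (U := EuclideanSpace ℝ (Fin d)) p (fun _ => η) I =
      fun _ => (dxBasis d).ExteriorAlgebra.repr η I := by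
    funext y
    have h1 : chartSymmDeriv (U := EuclideanSpace ℝ (Fin d)) p y = ContinuousLinearMap.id ℝ _ := by
      rw [chartSymmDeriv]
      simp only [mfld_simps]
      exact mfderiv_id
    have h2 : ∀ z : CotangentExt d, extPullback (ContinuousLinearMap.id ℝ _) z = z := by
      intro z
      simp [extPullback]
    rw [coordCoeff, coordRep, h1, h2]
  rw [hc]
  exact contDiffOn_const

/-! ### Specializations of the Weil algebra in constant forms and pure ghosts -/

section Ghosts

variable {d : ℕ} {B : Type u} [Ring B] [Algebra ℝ B] (ℬ : ℕ → Submodule ℝ B) [GradedAlgebra ℬ]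

open GradedTensorProduct

/-- The part of ghost degree `j` of a fibre. -/
def ghostPart (d : ℕ) (j : ℕ) : Submodule ℝ (GhostFibre d ℬ) :=
  Submodule.span ℝ {s | ∃ (a : CotangentExt d) (b : B), b ∈ ℬ j ∧ s = tmul ℝ a b}

/-- The projection of a fibre onto its part of ghost degree `j`. -/
def ghostProj (d : ℕ) (j : ℕ) : GhostFibre d ℬ →ₗ[ℝ] GhostFibre d ℬ :=
  (of ℝ (cotangentGrading d) ℬ).toLinearMap ∘ₗ
    TensorProduct.map LinearMap.id (GradedAlgebra.proj ℬ j) ∘ₗ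
      (of ℝ (cotangentGrading d) ℬ).symm.toLinearMap

variable {ℬ}

theorem ghostProj_tmul {i j : ℕ} (a : CotangentExt d) {b : B} (hb : b ∈ ℬ i) :
    ghostProj ℬ d j (tmul ℝ a b) = if i = j then tmul ℝ a b else 0 := by
  have h : ghostProj ℬ d j (tmul ℝ a b) = tmul ℝ a (GradedAlgebra.proj ℬ j b) := rfl
  rw [h, GradedAlgebra.proj_apply, DirectSum.decompose_of_mem ℬ hb, DirectSum.of_apply]
  split_ifs with hij
  · subst hij
    rfl
  · simp

theorem ghostProj_eq_zero {i j : ℕ} (hij : i ≠ j) {x : GhostFibre d ℬ} (hx : x ∈ ghostPart ℬ d i) :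
    ghostProj ℬ d j x = 0 := by
  have : ghostPart ℬ d i ≤ LinearMap.ker (ghostProj ℬ d j) := by
    refine Submodule.span_le.2 ?_
    rintro _ ⟨a, b, hb, rfl⟩
    rw [SetLike.mem_coe, LinearMap.mem_ker, ghostProj_tmul a hb, if_neg hij]
  exact this hx

theorem apply_mem_ghostPart {U : Type v} [TopologicalSpace U]
    [ChartedSpace (EuclideanSpace ℝ (Fin d)) U] {k j : ℕ} {s : U → GhostFibre d ℬ}
    (hs : s ∈ ghostForms d U ℬ k j) (x : U) : s x ∈ ghostPart ℬ d j := by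
  have : ghostForms d U ℬ k j ≤ (ghostPart ℬ d j).comap (LinearMap.proj x) := by
    refine Submodule.span_le.2 ?_
    rintro _ ⟨η, b, -, hb, rfl⟩
    exact Submodule.subset_span ⟨η x, b, hb, rfl⟩
  exact this hs

theorem one_tmul_mul_tmul_one {i j : ℕ} {a : CotangentExt d} {b : B}
    (ha : a ∈ cotangentGrading d i) (hb : b ∈ ℬ j) :
    (tmul ℝ 1 b * tmul ℝ a 1 : GhostFibre d ℬ) = ((-1 : ℝ) ^ (j * i)) • tmul ℝ a b := by
  have h := tmul_coe_mul_coe_tmul (R := ℝ) (cotangentGrading d) ℬ 1 ⟨b, hb⟩ ⟨a, ha⟩ 1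
  simp only [one_mul, mul_one] at h
  refine h.trans ?_
  rw [Units.smul_def, ← Int.cast_smul_eq_zsmul ℝ]
  congr 1
  push_cast
  rfl

end Ghosts

namespace LInfinityAlgebra

variable (L : LInfinityAlgebra.{u}) {d : ℕ} {B : Type u} [Ring B] [Algebra ℝ B]
  {ℬ : ℕ → Submodule ℝ B} [GradedAlgebra ℬ]

open GradedTensorProduct

/-- The values `t^α ↦ 1 ⊗ b_α`, `σ(t^α) ↦ F_α ⊗ 1`. -/
def testGen (ℬ : ℕ → Submodule ℝ B) [GradedAlgebra ℬ] (F : L.Idx → CotangentExt d) (b : L.Idx → B) :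
    L.Idx ⊕ L.Idx → GhostFibre d ℬ :=
  Sum.elim (fun α => tmul ℝ 1 (b α)) (fun α => tmul ℝ (F α) 1)

theorem testGen_comm {F : L.Idx → CotangentExt d} {b : L.Idx → B}
    (hB : ∀ i j, ∀ a ∈ ℬ i, ∀ b ∈ ℬ j, a * b = ((-1 : ℝ) ^ (i * j)) • (b * a))
    (hF : ∀ α, F α ∈ cotangentGrading d (L.deg α + 1)) (hb : ∀ α, b α ∈ ℬ (L.deg α))
    (g h : L.Idx ⊕ L.Idx) : L.testGen ℬ F b g * L.testGen ℬ F b h =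
      ((-1 : ℝ) ^ (L.wdeg g * L.wdeg h)) • (L.testGen ℬ F b h * L.testGen ℬ F b g) := by
  rcases g with α | α <;> rcases h with β | β
  · change includeRight (cotangentGrading d) ℬ (b α) * includeRight (cotangentGrading d) ℬ (b β) =
      _ • (includeRight (cotangentGrading d) ℬ (b β) * includeRight (cotangentGrading d) ℬ (b α))
    rw [← map_mul, ← map_mul, ← map_smul]
    exact congrArg _ (hB _ _ _ (hb α) _ (hb β))
  · refine (one_tmul_mul_tmul_one (hF β) (hb α)).trans ?_
    exact congrArg _ (tmul_one_mul_one_tmul (cotangentGrading d) ℬ (F β) (b α)).symm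
  · have h1 := one_tmul_mul_tmul_one (hF α) (hb β)
    refine (tmul_one_mul_one_tmul (cotangentGrading d) ℬ (F α) (b β)).trans ?_
    refine Eq.trans ?_ (congrArg _ h1.symm)
    rw [smul_smul, mul_comm (L.deg β)]
    exact (one_smul ℝ _).symm.trans (congrArg (· • _) (FreeGC.neg_one_pow_sq _).symm)
  · change includeLeft (cotangentGrading d) ℬ (F α) * includeLeft (cotangentGrading d) ℬ (F β) =
      _ • (includeLeft (cotangentGrading d) ℬ (F β) * includeLeft (cotangentGrading d) ℬ (F α))
    rw [← map_mul, ← map_mul, ← map_smul]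
    exact congrArg _ (ExteriorAlgebra.mul_comm_of_mem_exteriorPower (hF α) (hF β))

/-- The homomorphism `t^α ↦ x_α (1 ⊗ b_α)`, `σ(t^α) ↦ x'_α (F_α ⊗ 1)`: all potentials are pure
ghosts of maximal ghost degree, all curvatures have ghost degree zero. The scaling parameters `x`
serve to separate monomials. -/
def testHom {F : L.Idx → CotangentExt d} {b : L.Idx → B}
    (hB : ∀ i j, ∀ a ∈ ℬ i, ∀ b ∈ ℬ j, a * b = ((-1 : ℝ) ^ (i * j)) • (b * a))
    (hF : ∀ α, F α ∈ cotangentGrading d (L.deg α + 1)) (hb : ∀ α, b α ∈ ℬ (L.deg α))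
    (x : L.Idx ⊕ L.Idx → ℝ) : L.Weil →ₐ[ℝ] GhostFibre d ℬ :=
  FreeGC.lift (fun g => x g • L.testGen ℬ F b g) (fun g h => by
    rw [smul_mul_smul_comm, smul_mul_smul_comm, L.testGen_comm hB hF hb g h, smul_comm,
      mul_comm (x g)])

theorem prod_mem_ghost {b : L.Idx → B} (hb : ∀ α, b α ∈ ℬ (L.deg α)) (l : List L.Idx) :
    (l.map b).prod ∈ ℬ (l.map L.deg).sum := by
  induction l with
  | nil => simpa using SetLike.GradedOne.one_mem
  | cons α l ih =>
    simp only [List.map_cons, List.prod_cons, List.sum_cons]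
    exact SetLike.GradedMul.mul_mem (hb α) ih

section

variable {F : L.Idx → CotangentExt d} {b : L.Idx → B}
    (hB : ∀ i j, ∀ a ∈ ℬ i, ∀ b ∈ ℬ j, a * b = ((-1 : ℝ) ^ (i * j)) • (b * a))
    (hF : ∀ α, F α ∈ cotangentGrading d (L.deg α + 1)) (hb : ∀ α, b α ∈ ℬ (L.deg α))

theorem testHom_gen (x : L.Idx ⊕ L.Idx → ℝ) (g : L.Idx ⊕ L.Idx) :
    L.testHom hB hF hb x (FreeGC.gen L.wdeg g) = x g • L.testGen ℬ F b g :=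
  FreeGC.lift_gen _ _ g

theorem testHom_word (x : L.Idx ⊕ L.Idx → ℝ) (w : List (L.Idx ⊕ L.Idx)) :
    L.testHom hB hF hb x (w.map (FreeGC.gen L.wdeg)).prod =
      (w.map x).prod • L.testHom hB hF hb 1 (w.map (FreeGC.gen L.wdeg)).prod := by
  induction w with
  | nil => simp
  | cons g w ih =>
    simp only [List.map_cons, List.prod_cons, map_mul, ih, testHom_gen, Pi.one_apply, one_smul]
    rw [smul_mul_smul_comm]

theorem testHom_sorted_word (m l : List L.Idx) :
    L.testHom hB hF hb 1
        ((m.map Sum.inr ++ l.map Sum.inl).map (FreeGC.gen L.wdeg)).prod =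
      tmul ℝ (m.map F).prod (l.map b).prod := by
  have h1 : L.testHom hB hF hb 1 ((m.map Sum.inr).map (FreeGC.gen L.wdeg)).prod =
      includeLeft (cotangentGrading d) ℬ (m.map F).prod := by
    rw [map_list_prod, map_list_prod, List.map_map, List.map_map, List.map_map]
    congr 1
    refine List.map_congr_left fun α _ => ?_
    refine (L.testHom_gen hB hF hb 1 (Sum.inr α)).trans ?_
    rw [Pi.one_apply, one_smul]
    rfl
  have h2 : L.testHom hB hF hb 1 ((l.map Sum.inl).map (FreeGC.gen L.wdeg)).prod =
      includeRight (cotangentGrading d) ℬ (l.map b).prod := by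
    rw [map_list_prod, map_list_prod, List.map_map, List.map_map, List.map_map]
    congr 1
    refine List.map_congr_left fun α _ => ?_
    refine (L.testHom_gen hB hF hb 1 (Sum.inl α)).trans ?_
    rw [Pi.one_apply, one_smul]
    rfl
  rw [List.map_append, List.prod_append, map_mul, h1, h2]
  exact tmul_one_mul_one_tmul (cotangentGrading d) ℬ _ _

/-- The image of a word is homogeneous, its ghost degree being the `t`-degree of the word. -/
theorem ghostProj_testHom_word (j : ℕ) (w : List (L.Idx ⊕ L.Idx)) :
    ghostProj ℬ d j (L.testHom hB hF hb 1 (w.map (FreeGC.gen L.wdeg)).prod) =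
      if L.tdeg w = j then L.testHom hB hF hb 1 (w.map (FreeGC.gen L.wdeg)).prod else 0 := by
  obtain ⟨m, l, h⟩ := exists_perm L w
  obtain ⟨c, -, hc⟩ := FreeGC.exists_prod_eq_smul_of_perm (deg := L.wdeg) h
  rw [hc, map_smul, map_smul, testHom_sorted_word, L.tdeg_perm h, L.tdeg_append,
    ghostProj_tmul _ (L.prod_mem_ghost hb l), smul_ite, smul_zero]

end

/-- An algebra of ghosts large enough to contain products of arbitrarily many ghosts of any
degrees: the exterior algebra on countably many generators, lifted to the universe of the
parameter algebras. -/
abbrev GhostAlgebra : Type u := ExteriorAlgebra ℝ (ULift.{u} ℕ →₀ ℝ)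

/-- The degree-`k` part of the algebra of ghosts. -/
abbrev ghostGrading (k : ℕ) : Submodule ℝ GhostAlgebra.{u} := ⋀[ℝ]^k (ULift.{u} ℕ →₀ ℝ)

theorem ghostGrading_comm (i j : ℕ) : ∀ a ∈ ghostGrading.{u} i, ∀ b ∈ ghostGrading.{u} j,
    a * b = ((-1 : ℝ) ^ (i * j)) • (b * a) :=
  fun _ ha _ hb => ExteriorAlgebra.mul_comm_of_mem_exteriorPower ha hb

/-- Every nonzero word is detected by one of the test homomorphisms. -/
theorem exists_testHom_ne_zero (w : List (L.Idx ⊕ L.Idx))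
    (hw : (w.map (FreeGC.gen L.wdeg)).prod ≠ 0) :
    ∃ (d : ℕ) (F : L.Idx → CotangentExt d) (b : L.Idx → GhostAlgebra.{u})
      (hF : ∀ α, F α ∈ cotangentGrading d (L.deg α + 1))
      (hb : ∀ α, b α ∈ ghostGrading.{u} (L.deg α)),
      L.testHom ghostGrading_comm hF hb 1
        (w.map (FreeGC.gen L.wdeg)).prod ≠ 0 := by
  obtain ⟨m, l, h⟩ := exists_perm L w
  obtain ⟨c, hc0, hc⟩ := FreeGC.exists_prod_eq_smul_of_perm (deg := L.wdeg) h
  have hml : ((m.map Sum.inr).map (FreeGC.gen L.wdeg)).prod *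
      ((l.map Sum.inl).map (FreeGC.gen L.wdeg)).prod ≠ 0 := by
    rw [← List.prod_append, ← List.map_append]
    intro h0
    exact hw (by rw [hc, h0, smul_zero])
  set d := ((m.map Sum.inr).map L.wdeg).sum with hd
  obtain ⟨f, hf, -, hfm⟩ := FreeGC.exists_exterior_prod_ne_zero (N := d)
    (M := Module.Dual ℝ (EuclideanSpace ℝ (Fin d)))
    (e := fun i => if h : i < d then dxBasis d ⟨i, h⟩ else 0)
    (D := fun i => if h : i < d then (dxBasis d).coord ⟨i, h⟩ else 0)
    (fun i hi => by simp [hi])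
    (fun i hi j hj => by
      have hj' : j < d := by omega
      have hne : (⟨j, hj'⟩ : Fin d) ≠ ⟨i, hi⟩ := fun e => hj.ne (congrArg Fin.val e)
      simp [hi, hj', hne])
    L.one_le_wdeg (m.map Sum.inr) (left_ne_zero_of_mul hml) le_rfl
  obtain ⟨f', hf', -, hfl⟩ := FreeGC.exists_exterior_prod_ne_zero
    (N := ((l.map Sum.inl).map L.wdeg).sum) (M := ULift.{u} ℕ →₀ ℝ)
    (e := fun i => Finsupp.single ⟨i⟩ 1) (D := fun i => Finsupp.lapply ⟨i⟩)
    (fun i _ => by simp)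
    (fun i _ j hj => by
      have hne : (ULift.up j : ULift.{u} ℕ) ≠ ⟨i⟩ := fun e => hj.ne (congrArg ULift.down e)
      simp [hne])
    L.one_le_wdeg (l.map Sum.inl) (right_ne_zero_of_mul hml) le_rfl
  have hF : ∀ α, f (Sum.inr α) ∈ cotangentGrading d (L.deg α + 1) := fun α => hf (Sum.inr α)
  have hb : ∀ α, f' (Sum.inl α) ∈ ghostGrading.{u} (L.deg α) := fun α => hf' (Sum.inl α)
  refine ⟨d, fun α => f (Sum.inr α), fun α => f' (Sum.inl α), hF, hb, ?_⟩
  rw [hc, map_smul, testHom_sorted_word]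
  refine smul_ne_zero hc0 ?_
  rw [List.map_map] at hfm hfl
  intro h0
  -- functionals that detect the two factors detect the pure tensor
  obtain ⟨u, hu⟩ := not_forall.1 (mt (Module.forall_dual_apply_eq_zero_iff ℝ _).1 hfm)
  obtain ⟨u', hu'⟩ := not_forall.1 (mt (Module.forall_dual_apply_eq_zero_iff ℝ _).1 hfl)
  have h1 := congrArg ((TensorProduct.lid ℝ ℝ).toLinearMap ∘ₗ TensorProduct.map u u') h0
  exact mul_ne_zero hu hu' h1

end LInfinityAlgebra

/-! ### Bianchi identities -/

namespace LInfinityAlgebra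

variable (L : LInfinityAlgebra.{u})

open Classical in
/-- If all test homomorphisms send an element of the Weil algebra to the sum of its parts of ghost
degrees `0` and `1`, then it is a combination of words with `t`-degree at most one: for any other
monomial, a word representing it is zero or detected by a test homomorphism, and its coefficient
can be isolated by scaling the generators. -/
theorem mem_span_of_forall_testHom_mem {p : ℕ} {P : L.Weil} (hP : P ∈ FreeGC.homog L.wdeg p)
    (H : ∀ (d : ℕ) (F : L.Idx → CotangentExt d) (b : L.Idx → GhostAlgebra.{u})
      (hF : ∀ α, F α ∈ cotangentGrading d (L.deg α + 1))
      (hb : ∀ α, b α ∈ ghostGrading.{u} (L.deg α)) (x : L.Idx ⊕ L.Idx → ℝ),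
      L.testHom ghostGrading_comm hF hb x P ∈ ghostPart ghostGrading.{u} d 0 ⊔
          ghostPart ghostGrading.{u} d 1) :
    P ∈ Submodule.span ℝ ((fun w : List (L.Idx ⊕ L.Idx) => (w.map (FreeGC.gen L.wdeg)).prod) ''
      {w | (w.map L.wdeg).sum = p ∧ L.tdeg w ≤ 1}) := by
  set word : List (L.Idx ⊕ L.Idx) → L.Weil := fun w => (w.map (FreeGC.gen L.wdeg)).prod with hword
  have hP' : P ∈ Submodule.span ℝ (word '' {w | (w.map L.wdeg).sum = p}) := hP
  obtain ⟨c, hc, hcP⟩ := (Finsupp.mem_span_image_iff_linearCombination ℝ).1 hP'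
  rw [Finsupp.linearCombination_apply, Finsupp.sum] at hcP
  have hvanish : ∀ w₀ : List (L.Idx ⊕ L.Idx), 1 < L.tdeg w₀ →
      ∑ w ∈ c.support with Multiset.ofList w = Multiset.ofList w₀, c w • word w = 0 := by
    intro w₀ hw₀
    by_cases h0 : word w₀ = 0
    · refine Finset.sum_eq_zero fun w hw => ?_
      obtain ⟨a, -, ha⟩ := FreeGC.exists_prod_eq_smul_of_perm (deg := L.wdeg)
        (Multiset.coe_eq_coe.1 (Finset.mem_filter.1 hw).2)
      have : word w = a • word w₀ := ha
      rw [this, h0, smul_zero, smul_zero]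
    obtain ⟨d, F, b, hF, hb, hne⟩ := L.exists_testHom_ne_zero w₀ h0
    specialize H d F b hF hb
    set ψ := L.testHom ghostGrading_comm hF hb with hψ
    set π := ghostProj ghostGrading.{u} d (L.tdeg w₀) with hπ
    have hzero : ∀ x, π (ψ x P) = 0 := by
      intro x
      obtain ⟨y, hy, z, hz, hyz⟩ := Submodule.mem_sup.1 (H x)
      rw [← hyz, map_add, ghostProj_eq_zero (by omega) hy, ghostProj_eq_zero (by omega) hz,
        add_zero]
    have hsum := sum_filter_eq_zero_of_forall_sum_prod_smul_eq_zero c.support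
      (fun w => c w • π (ψ 1 (word w))) (fun x => by
        rw [← hzero x, ← hcP, map_sum, map_sum]
        refine Finset.sum_congr rfl fun w _ => ?_
        rw [map_smul, map_smul, smul_comm, ← map_smul π]
        exact congrArg (fun y => c w • π y) (L.testHom_word ghostGrading_comm hF hb x w).symm)
      (Multiset.ofList w₀)
    -- all words with the same letters are multiples of `w₀`
    have hmult : ∃ a : ℝ, ∑ w ∈ c.support with Multiset.ofList w = Multiset.ofList w₀,
        c w • word w = a • word w₀ := by
      have : ∀ w, Multiset.ofList w = Multiset.ofList w₀ → ∃ a : ℝ, c w • word w = a • word w₀ := by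
        intro w hw
        obtain ⟨a, -, ha⟩ := FreeGC.exists_prod_eq_smul_of_perm (deg := L.wdeg)
          (Multiset.coe_eq_coe.1 hw)
        refine ⟨c w * a, ?_⟩
        rw [← smul_smul]
        exact congrArg _ ha
      choose! a ha using this
      refine ⟨∑ w ∈ c.support with Multiset.ofList w = Multiset.ofList w₀, a w, ?_⟩
      rw [Finset.sum_smul]
      exact Finset.sum_congr rfl fun w hw => ha w (Finset.mem_filter.1 hw).2
    obtain ⟨a, ha⟩ := hmult
    have hψa : ψ 1 (a • word w₀) = 0 := by
      rw [← ha, map_sum, ← hsum]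
      refine Finset.sum_congr rfl fun w hw => ?_
      have hw' := L.tdeg_perm (Multiset.coe_eq_coe.1 (Finset.mem_filter.1 hw).2)
      rw [map_smul, hπ, hψ, hword, ghostProj_testHom_word, if_pos hw']
    rw [map_smul] at hψa
    rw [ha, (smul_eq_zero.1 hψa).resolve_right hne, zero_smul]
  have hhigh : ∑ w ∈ c.support with ¬ L.tdeg w ≤ 1, c w • word w = 0 := by
    rw [← Finset.sum_fiberwise_of_maps_to
      (g := fun w : List (L.Idx ⊕ L.Idx) => Multiset.ofList w)
      (t := (c.support.filter fun w => ¬ L.tdeg w ≤ 1).image fun w => Multiset.ofList w)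
      (fun w hw => Finset.mem_image_of_mem _ hw)]
    refine Finset.sum_eq_zero fun μ hμ => ?_
    obtain ⟨w₀, hw₀, rfl⟩ := Finset.mem_image.1 hμ
    have hw₀' := (Finset.mem_filter.1 hw₀).2
    rw [← hvanish w₀ (by omega), Finset.filter_filter]
    refine Finset.sum_congr (Finset.filter_congr fun w _ => ?_) fun _ _ => rfl
    refine ⟨fun h => h.2, fun h => ⟨?_, h⟩⟩
    rwa [L.tdeg_perm (Multiset.coe_eq_coe.1 h)]
  rw [← hcP, ← Finset.sum_filter_add_sum_filter_not c.support (fun w => L.tdeg w ≤ 1), hhigh,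
    add_zero]
  refine Submodule.sum_mem _ fun w hw => Submodule.smul_mem _ _ (Submodule.subset_span ⟨w, ?_, rfl⟩)
  obtain ⟨h1, h2⟩ := Finset.mem_filter.1 hw
  exact ⟨hc h1, h2⟩

variable {L}

theorem WeilAut.symm_t (φ : L.WeilAut) (α : L.Idx) : φ.toAlgEquiv.symm (L.t α) = L.t α := by
  rw [AlgEquiv.symm_apply_eq, φ.map_t]

/-- The polynomial that expresses the Weil differential of `φ(σ(t^α))` by the free generators `t` and
`φ(σ(t))`, with `σ(t)` written for `φ(σ(t))`. -/
def WeilAut.bianchi (φ : L.WeilAut) (α : L.Idx) : L.Weil :=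
  φ.toAlgEquiv.symm (L.dW (φ.toAlgEquiv (L.st α)))

/-- `φ⁻¹` preserves degrees as well, because `φ` commutes with the projections onto the homogeneous
components. -/
theorem WeilAut.bianchi_mem (φ : L.WeilAut) (α : L.Idx) :
    φ.bianchi α ∈ FreeGC.homog L.wdeg (L.deg α + 2) := by
  refine FreeGC.mem_homog_of_map_mem φ.toAlgEquiv.toLinearMap φ.toAlgEquiv.injective φ.map_homog ?_
  have h : φ.toAlgEquiv.toLinearMap (φ.bianchi α) = L.dW (φ.toAlgEquiv (L.st α)) :=
    φ.toAlgEquiv.apply_symm_apply _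
  rw [h]
  exact FreeGC.der_mem _ _ (φ.map_homog _ _ (FreeGC.gen_mem (deg := L.wdeg) (Sum.inr α)))

/-- The adjustment condition on `ℝ^d`, applied to the constant section `testHom ∘ φ⁻¹` and evaluated
at the origin. -/
theorem WeilAut.IsAdjustment.testHom_bianchi_mem {φ : L.WeilAut} (hφ : φ.IsAdjustment) (α : L.Idx)
    {d : ℕ} {B : Type u} [Ring B] [Algebra ℝ B] {ℬ : ℕ → Submodule ℝ B} [GradedAlgebra ℬ]
    {F : L.Idx → CotangentExt d} {b : L.Idx → B}
    (hB : ∀ i j, ∀ a ∈ ℬ i, ∀ b ∈ ℬ j, a * b = ((-1 : ℝ) ^ (i * j)) • (b * a))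
    (hF : ∀ α, F α ∈ cotangentGrading d (L.deg α + 1)) (hb : ∀ α, b α ∈ ℬ (L.deg α))
    (x : L.Idx ⊕ L.Idx → ℝ) :
    L.testHom hB hF hb x (φ.bianchi α) ∈ ghostPart ℬ d 0 ⊔ ghostPart ℬ d 1 := by
  have h := hφ d (EuclideanSpace ℝ (Fin d)) B ℬ hB
    ((Pi.constAlgHom ℝ (EuclideanSpace ℝ (Fin d)) (GhostFibre d ℬ)).comp
      ((L.testHom hB hF hb x).comp φ.toAlgEquiv.symm.toAlgHom)) ?_ ?_ α
  · obtain ⟨y, hy, z, hz, hyz⟩ := Submodule.mem_sup.1 h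
    have h0 := congrFun hyz 0
    exact Submodule.mem_sup.2 ⟨y 0, apply_mem_ghostPart hy 0, z 0, apply_mem_ghostPart hz 0, h0⟩
  · intro β
    refine Submodule.mem_iSup_of_mem (L.deg β) (Submodule.mem_iSup_of_mem (by simp) ?_)
    have e : L.testHom hB hF hb x (φ.toAlgEquiv.symm (L.t β)) =
        x (Sum.inl β) • GradedTensorProduct.tmul ℝ 1 (b β) := by
      rw [φ.symm_t]
      exact L.testHom_gen hB hF hb x (Sum.inl β)
    have e' : ((Pi.constAlgHom ℝ (EuclideanSpace ℝ (Fin d)) (GhostFibre d ℬ)).comp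
      ((L.testHom hB hF hb x).comp φ.toAlgEquiv.symm.toAlgHom)) (L.t β) =
        x (Sum.inl β) • (fun _ : EuclideanSpace ℝ (Fin d) =>
          (GradedTensorProduct.tmul ℝ 1 (b β) : GhostFibre d ℬ)) := funext fun _ => e
    rw [e', Nat.sub_self]
    exact Submodule.smul_mem _ _ (Submodule.subset_span ⟨fun _ => 1, b β,
      isForm_const (by simp), hb β, rfl⟩)
  · intro β
    have e : L.testHom hB hF hb x (φ.toAlgEquiv.symm (φ.toAlgEquiv (L.st β))) =
        x (Sum.inr β) • GradedTensorProduct.tmul ℝ (F β) 1 := by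
      rw [AlgEquiv.symm_apply_apply]
      exact L.testHom_gen hB hF hb x (Sum.inr β)
    have e' : ((Pi.constAlgHom ℝ (EuclideanSpace ℝ (Fin d)) (GhostFibre d ℬ)).comp
      ((L.testHom hB hF hb x).comp φ.toAlgEquiv.symm.toAlgHom)) (φ.toAlgEquiv (L.st β)) =
        x (Sum.inr β) • (fun _ : EuclideanSpace ℝ (Fin d) =>
          (GradedTensorProduct.tmul ℝ (F β) 1 : GhostFibre d ℬ)) := funext fun _ => e
    rw [e']
    exact Submodule.smul_mem _ _ (Submodule.subset_span ⟨fun _ => F β, 1,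
      isForm_const (hF β), SetLike.GradedOne.one_mem, rfl⟩)

/-- The elements `t^β σ(t^{γ₁}) ⋯ σ(t^{γᵢ}) / i!`, which give the terms of the Bianchi identity that
are linear in a gauge potential. -/
def linearTerm (L : LInfinityAlgebra.{u}) (p : L.Idx × List L.Idx) : L.Weil :=
  (p.2.length.factorial : ℝ)⁻¹ • (L.t p.1 * (p.2.map L.st).prod)

/-- The elements `σ(t^{γ₁}) ⋯ σ(t^{γᵢ}) / i!`, which give the terms of the Bianchi identity that
contain curvatures only. -/
def curvatureTerm (L : LInfinityAlgebra.{u}) (l : List L.Idx) : L.Weil :=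
  (l.length.factorial : ℝ)⁻¹ • (l.map L.st).prod

/-- A word of degree at least three contains at most one letter `t^β` if its `t`-degree is at most
one, then `t^β` has degree one, and at least one letter `σ(t^γ)` is left. -/
theorem word_mem_span_sup_span {p : ℕ} (hp : 2 < p) {w : List (L.Idx ⊕ L.Idx)}
    (hw : (w.map L.wdeg).sum = p) (ht : L.tdeg w ≤ 1) :
    (w.map (FreeGC.gen L.wdeg)).prod ∈
      Submodule.span ℝ (L.linearTerm '' {q | L.deg q.1 = 1 ∧ q.2 ≠ []}) ⊔
        Submodule.span ℝ (L.curvatureTerm '' {l | l ≠ []}) := by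
  obtain ⟨m, l, h⟩ := L.exists_perm w
  -- the letters `t^β` are those in `l`; as they have positive degrees, `l` has at most one entry
  rw [L.tdeg_perm h, L.tdeg_append] at ht
  rw [(h.map L.wdeg).sum_eq] at hw
  have hfac : (m.length.factorial : ℝ) ≠ 0 := Nat.cast_ne_zero.2 (Nat.factorial_ne_zero _)
  rcases l with _ | ⟨β, _ | ⟨γ, l⟩⟩
  · obtain ⟨c, -, hc⟩ := FreeGC.exists_prod_eq_smul_of_perm (deg := L.wdeg) h
    have hm : m ≠ [] := by
      rintro rfl
      simp at hw
      omega
    refine Submodule.mem_sup_right ?_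
    have e : (w.map (FreeGC.gen L.wdeg)).prod =
        (c * m.length.factorial) • L.curvatureTerm m := by
      rw [hc, curvatureTerm, smul_smul, mul_assoc, mul_inv_cancel₀ hfac, mul_one, List.map_nil,
        List.append_nil, List.map_map]
      rfl
    rw [e]
    exact Submodule.smul_mem _ _ (Submodule.subset_span ⟨m, hm, rfl⟩)
  · have hβ : L.deg β = 1 := by
      have := L.one_le_deg β
      simp at ht
      omega
    have hm : m ≠ [] := by
      rintro rfl
      simp [wdeg] at hw
      omega
    have h' : w.Perm (Sum.inl β :: m.map Sum.inr) := h.trans List.perm_append_comm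
    obtain ⟨c, -, hc⟩ := FreeGC.exists_prod_eq_smul_of_perm (deg := L.wdeg) h'
    refine Submodule.mem_sup_left ?_
    have e : (w.map (FreeGC.gen L.wdeg)).prod =
        (c * m.length.factorial) • L.linearTerm (β, m) := by
      rw [hc, linearTerm, smul_smul, mul_assoc, mul_inv_cancel₀ hfac, mul_one, List.map_cons,
        List.prod_cons, List.map_map]
      rfl
    rw [e]
    exact Submodule.smul_mem _ _ (Submodule.subset_span ⟨(β, m), ⟨hβ, hm⟩, rfl⟩)
  · have := L.one_le_deg β
    have := L.one_le_deg γ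
    simp at ht
    omega

theorem WeilAut.IsAdjustment.exists_bianchi_eq {φ : L.WeilAut} (hφ : φ.IsAdjustment) (α : L.Idx) :
    ∃ (m : List L.Idx →₀ ℝ) (n : (L.Idx × List L.Idx) →₀ ℝ), m [] = 0 ∧ (∀ β, n (β, []) = 0) ∧
      (∀ β l, n (β, l) ≠ 0 → L.deg β = 1) ∧
      φ.bianchi α = (n.sum fun p c => c • L.linearTerm p) +
        m.sum fun l c => c • L.curvatureTerm l := by
  have h := L.mem_span_of_forall_testHom_mem (φ.bianchi_mem α)
    fun d F b hF hb x => hφ.testHom_bianchi_mem α ghostGrading_comm hF hb x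
  have h' : φ.bianchi α ∈
      Submodule.span ℝ (L.linearTerm '' {q | L.deg q.1 = 1 ∧ q.2 ≠ []}) ⊔
        Submodule.span ℝ (L.curvatureTerm '' {l | l ≠ []}) := by
    refine Submodule.span_le.2 ?_ h
    rintro _ ⟨w, ⟨hw, ht⟩, rfl⟩
    have := L.one_le_deg α
    exact word_mem_span_sup_span (by omega) hw ht
  obtain ⟨y, hy, z, hz, hyz⟩ := Submodule.mem_sup.1 h'
  obtain ⟨n, hn, rfl⟩ := (Finsupp.mem_span_image_iff_linearCombination ℝ).1 hy
  obtain ⟨m, hm, rfl⟩ := (Finsupp.mem_span_image_iff_linearCombination ℝ).1 hz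
  refine ⟨m, n, ?_, fun β => ?_, fun β l hl => ?_, hyz.symm⟩
  · by_contra h0
    exact hm (Finsupp.mem_support_iff.2 h0) rfl
  · by_contra h0
    exact (hn (Finsupp.mem_support_iff.2 h0)).2 rfl
  · exact (hn (Finsupp.mem_support_iff.2 hl)).1

end LInfinityAlgebra

end

theorem mainTheorem8 (L : LInfinityAlgebra.{u}) (φ : L.WeilAut) (hφ : φ.IsAdjustment) :
    ∃ (m : L.Idx → List L.Idx →₀ ℝ) (n : L.Idx → (L.Idx × List L.Idx) →₀ ℝ),
      (∀ α, m α [] = 0) ∧ (∀ α β, n α (β, []) = 0) ∧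
      (∀ α β l, n α (β, l) ≠ 0 → L.deg β = 1) ∧
      ∀ (d : ℕ) (U : Type v) [TopologicalSpace U] [ChartedSpace (EuclideanSpace ℝ (Fin d)) U]
        [IsManifold (𝓡 d) ∞ U] [T2Space U] [SecondCountableTopology U] [ContractibleSpace U]
        (𝒜 : L.Connection d U) (α : L.Idx),
        extD (𝒜.curvature φ α) =
          ((n α).sum fun p c => ((p.2.length.factorial : ℝ)⁻¹ * c) •
            (𝒜.potential p.1 * (p.2.map (𝒜.curvature φ)).prod)) +
          ((m α).sum fun l c => ((l.length.factorial : ℝ)⁻¹ * c) •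
            (l.map (𝒜.curvature φ)).prod) := by
  choose m n hm hn hn1 h using hφ.exists_bianchi_eq
  refine ⟨m, n, hm, hn, hn1, ?_⟩
  intro d U _ _ _ _ _ _ 𝒜 α
  have hprod : ∀ l : List L.Idx, 𝒜.toAlgHom (φ.toAlgEquiv (l.map L.st).prod) =
      (l.map (𝒜.curvature φ)).prod := fun l => by
    rw [map_list_prod, map_list_prod, List.map_map, List.map_map]
    rfl
  have hd : extD (𝒜.curvature φ α) = 𝒜.toAlgHom (φ.toAlgEquiv (φ.bianchi α)) := by
    rw [LInfinityAlgebra.WeilAut.bianchi, AlgEquiv.apply_symm_apply, 𝒜.map_d]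
    rfl
  rw [hd, h α, map_add, map_add, Finsupp.sum, Finsupp.sum, map_sum, map_sum, map_sum, map_sum]
  congr 1
  · refine Finset.sum_congr rfl fun p _ => ?_
    rw [map_smul, map_smul, LInfinityAlgebra.linearTerm, map_smul, map_smul, map_mul, map_mul,
      hprod, φ.map_t, smul_smul, mul_comm]
    rfl
  · refine Finset.sum_congr rfl fun l _ => ?_
    rw [map_smul, map_smul, LInfinityAlgebra.curvatureTerm, map_smul, map_smul, hprod, smul_smul,
      mul_comm]
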